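/- Let $X$ be a complex manifold and let $B\subset X$ be an open polydisc, i.e. an open subset which is isomorphic, as a complex manifold, to $\{z\in\mathbb{C}^d : |z_i|<1 \ \forall i\}$ for some $d$. Let $\mathcal{O}(B)$ be the Fréchet algebra of complex-analytic functions on $B$, with the topology of uniform convergence on compact subsets, let $n\ge 0$, and let $G:=\mathrm{GL}_n(\mathcal{O}(B))$, containing the unitary group $U_n$ as constant matrices. Here a curve in a real topological vector space is smooth if all its iterated derivatives (limits of difference quotients) exist, a curve $\mathbb{R}\to G$ is smooth if it is smooth as a curve in the space of matrices $M_n(\mathcal{O}(B))$, a curve in a product is smooth if its components are, a curve in the quotient $U_n\backslash G$ by left multiplication is smooth if it lifts locally to a smooth curve in $G$, and a map is smooth ($C^\infty$) if it takes smooth curves to smooth curves. Then the inclusion $U_n\to G$ is a smooth $U_n$-equivariant deformation retract: there exists a smooth map $$h\colon G\times\mathbb{R}\to G$$ with $h(ug,t)=u\,h(g,t)$ for all $u\in U_n$, $g\in G$, $t\in\mathbb{R}$, such that $h(-,1)$ is the identity and $h(-,0)$ is a retraction of $G$ onto $U_n$ (that is, $h(g,0)\in U_n$ for all $g\in G$ and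 $h(u,0)=u$ for all $u\in U_n$). In particular, $M:=U_n\backslash G$ is smoothly contractible: there exist a smooth map $H\colon M\times\mathbb{R}\to M$ and a point $m_0\in M$ with $H(m,1)=m$ and $H(m,0)=m_0$ for all $m\in M$. -/

import Mathlib

open scoped Manifold ContDiff MatrixGroups Topology

/-! ### Smooth curves and smooth maps -/

section Smooth

/-- The smooth curves `ℝ → F` in a real topological vector space `F`: curves all of whose iterated
derivatives (limits of difference quotients in the topology of `F`) exist. `D k` is the `k`-th
derivative of the curve. -/
def smoothCurves (F : Type*) [AddCommGroup F] [Module ℝ F] [TopologicalSpace F] : Set (ℝ → F) :=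
  {c | ∃ D : ℕ → ℝ → F, D 0 = c ∧
    ∀ (k : ℕ) (t : ℝ), Filter.Tendsto (slope (D k) t) (𝓝[≠] t) (𝓝 (D (k + 1) t))}

/-- A curve in a product is smooth if both of its components are. -/
def prodCurves {M N : Type*} (C : Set (ℝ → M)) (D : Set (ℝ → N)) : Set (ℝ → M × N) :=
  {c | (fun t => (c t).1) ∈ C ∧ (fun t => (c t).2) ∈ D}

/-- The smooth curves in a quotient of a space with given smooth curves `C`: those curves that
locally lift to smooth curves. -/
def quotientCurves {M : Type*} (s : Setoid M) (C : Set (ℝ → M)) : Set (ℝ → Quotient s) :=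
  {c | ∀ t₀ : ℝ, ∃ γ ∈ C, ∀ᶠ t in 𝓝 t₀, c t = Quotient.mk s (γ t)}

/-- A map is smooth (`C^∞`) if it takes smooth curves to smooth curves; `C` and `D` are the sets
of smooth curves of its source and its target. -/
def IsSmoothMap {M N : Type*} (C : Set (ℝ → M)) (D : Set (ℝ → N)) (f : M → N) : Prop :=
  ∀ c ∈ C, (fun t => f (c t)) ∈ D

/-- A space `M` with smooth curves `C` is smoothly contractible: there is a smooth map
`H : M × ℝ → M` with `H(-, 1)` the identity and `H(-, 0)` constant. -/
def SmoothlyContractible {M : Type*} (C : Set (ℝ → M)) : Prop :=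
  ∃ H : M × ℝ → M, IsSmoothMap (prodCurves C (smoothCurves ℝ)) C H ∧
    (∀ m, H (m, 1) = m) ∧ ∃ m₀, ∀ m, H (m, 0) = m₀

end Smooth

/-! ### Open polydiscs and holomorphic functions -/

/-- The open unit polydisc `{z ∈ ℂ^d : |z_i| < 1 for all i}`. -/
def unitPolydisc (d : ℕ) : TopologicalSpace.Opens (Fin d → ℂ) where
  carrier := {z | ∀ i, ‖z i‖ < 1}
  is_open' := by
    simp only [Set.ofPred_forall]
    exact isOpen_iInter_of_finite fun i =>
      isOpen_lt (continuous_apply i).norm continuous_const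

section Holomorphic

variable (E : Type*) [NormedAddCommGroup E] [NormedSpace ℂ E]
  {X : Type*} [TopologicalSpace X] [ChartedSpace E X]

/-- An open subset of a complex manifold is an open polydisc if it is isomorphic, as a complex
manifold, to the open unit polydisc in some `ℂ^d`. -/
def IsOpenPolydisc (B : TopologicalSpace.Opens X) : Prop :=
  ∃ d : ℕ, Nonempty (B ≃ₘ^ω⟮𝓘(ℂ, E), 𝓘(ℂ, Fin d → ℂ)⟯ unitPolydisc d)

/-- The algebra `𝒪(B)` of complex-analytic functions on an open subset `B` of a complex manifold.
As a subspace of `C(B, ℂ)` with the compact-open topology, it carries the Fréchet topology of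
uniform convergence on compact subsets of `B`. -/
def holomorphicFunctions (B : TopologicalSpace.Opens X) : Subalgebra ℂ C(B, ℂ) where
  carrier := {f | ContMDiff 𝓘(ℂ, E) 𝓘(ℂ) ω f}
  mul_mem' hf hg := ContMDiff.mul hf hg
  add_mem' hf hg := ContMDiff.add hf hg
  algebraMap_mem' _ := contMDiff_const

end Holomorphic

/-! ### The general linear group -/

section GeneralLinear

variable (n : ℕ) (A : Type*) [CommRing A] [Algebra ℂ A]

/-- The smooth curves in `GL_n(A)`: those that are smooth as curves in the space `M_n(A)` of
matrices, with the entrywise topology. -/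
def glCurves [TopologicalSpace A] : Set (ℝ → GL (Fin n) A) :=
  {c | (fun t => (c t : Matrix (Fin n) (Fin n) A)) ∈
    @smoothCurves (Matrix (Fin n) (Fin n) A) _ (Module.complexToReal _) _}

/-- The inclusion `U_n → GL_n(A)` of the unitary group as constant matrices. -/
def unitaryToGL : Matrix.unitaryGroup (Fin n) ℂ →* GL (Fin n) A :=
  (Matrix.GeneralLinearGroup.map (algebraMap ℂ A)).comp Unitary.toUnits

/-- The equivalence relation on `GL_n(A)` whose classes are the orbits of left multiplication by
`U_n`, so that `Quotient (unitarySetoid n A)` is `U_n \ GL_n(A)`. -/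
def unitarySetoid : Setoid (GL (Fin n) A) :=
  QuotientGroup.rightRel (unitaryToGL n A).range

/-- The inclusion `U_n → G = GL_n(A)` is a smooth `U_n`-equivariant deformation retract: there is
a smooth map `h : G × ℝ → G`, equivariant for left multiplication by `U_n`, with `h(-, 1)` the
identity and `h(-, 0)` a retraction of `G` onto `U_n`. -/
def IsSmoothUnitaryDeformationRetract [TopologicalSpace A] : Prop :=
  ∃ h : GL (Fin n) A × ℝ → GL (Fin n) A,
    IsSmoothMap (prodCurves (glCurves n A) (smoothCurves ℝ)) (glCurves n A) h ∧
    (∀ (u : Matrix.unitaryGroup (Fin n) ℂ) (g : GL (Fin n) A) (t : ℝ),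
      h (unitaryToGL n A u * g, t) = unitaryToGL n A u * h (g, t)) ∧
    (∀ g, h (g, 1) = g) ∧
    (∀ g, h (g, 0) ∈ (unitaryToGL n A).range) ∧
    ∀ u : Matrix.unitaryGroup (Fin n) ℂ, h (unitaryToGL n A u, 0) = unitaryToGL n A u

end GeneralLinear

/-! Identify `B` with the unit polydisc and write `a = g(0)` for the value at the centre and `|a| =
(a* a)^{1/2}`. The retraction is `h(g, t)(z) = g(s z) · ((1 - s)|a|⁻¹ + s)`, where `s = s(t)` in
`[0, 1]` is a smooth step function with `s(0) = 0` and `s(1) = 1`; the step is needed because `t`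
runs over all of `ℝ` while only dilations with `0 ≤ s ≤ 1` preserve the polydisc. The second factor
is positive definite, hence invertible. At `s = 1` the product is `g`, and at `s = 0` it is the
unitary part `a|a|⁻¹` of the polar decomposition. Since `|ua| = |a|` and the correction multiplies
on the right, `h` commutes with left multiplication by `U_n` and so descends to a contraction of the
quotient.

Smoothness has two sources. Differentiating a dilated curve gives dilated curves again, multiplied
by coordinate functions and smooth scalars (`hasCurveDeriv_dilate`), so a class of curves closed
under differentiation contains them all. Continuity of partial derivatives comes from Cauchy's
estimate (`continuous_polydiscDeriv`), and strict differentiability in `(t, z)` turns pointwise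
calculus into locally uniform convergence. Smoothness of `a ↦ |a|` is the inverse function theorem
for squaring (`contDiffAt_cfcAbs`). -/

open Filter Set

/-! ### Calculus of curves in complex topological vector spaces -/

section Curves

variable {F G : Type*} [AddCommGroup F] [Module ℂ F] [TopologicalSpace F]
  [AddCommGroup G] [Module ℂ G] [TopologicalSpace G]

/-- The curve `c'` is the derivative of the curve `c`. -/
def HasCurveDeriv (c c' : ℝ → F) : Prop :=
  ∀ t, Tendsto (fun τ : ℝ => (((τ - t)⁻¹ : ℝ) : ℂ) • (c τ - c t)) (𝓝[≠] t) (𝓝 (c' t))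

variable (F) in
/-- The smooth curves in a complex topological vector space. -/
abbrev complexSmoothCurves : Set (ℝ → F) := @smoothCurves F _ (Module.complexToReal F) _

theorem exists_hasCurveDeriv {c : ℝ → F} (hc : c ∈ complexSmoothCurves F) :
    ∃ c' ∈ complexSmoothCurves F, HasCurveDeriv c c' := by
  obtain ⟨D, rfl, hD⟩ := hc
  exact ⟨D 1, ⟨fun k => D (k + 1), rfl, fun k => hD (k + 1)⟩, hD 0⟩

/-- A set of curves each of which has a derivative in the same set consists of smooth curves. -/
theorem mem_complexSmoothCurves_of_closed {S : Set (ℝ → F)}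
    (hS : ∀ c ∈ S, ∃ c' ∈ S, HasCurveDeriv c c') {c : ℝ → F} (hc : c ∈ S) :
    c ∈ complexSmoothCurves F := by
  choose d hdS hd using hS
  let D : ℕ → S := fun k => Nat.rec ⟨c, hc⟩ (fun _ x => ⟨d x.1 x.2, hdS x.1 x.2⟩) k
  exact ⟨fun k => (D k).1, rfl, fun k => hd (D k).1 (D k).2⟩

theorem HasCurveDeriv.map {c c' : ℝ → F} (h : HasCurveDeriv c c') (L : F →ₗ[ℂ] G)
    (hL : Continuous L) : HasCurveDeriv (fun t => L (c t)) (fun t => L (c' t)) := fun t => by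
  simpa only [Function.comp_def, map_smul, map_sub] using (hL.tendsto (c' t)).comp (h t)

theorem complexSmoothCurves_map {c : ℝ → F} (hc : c ∈ complexSmoothCurves F) (L : F →ₗ[ℂ] G)
    (hL : Continuous L) : (fun t => L (c t)) ∈ complexSmoothCurves G := by
  obtain ⟨D, rfl, hD⟩ := hc
  exact ⟨fun k t => L (D k t), rfl, fun k => HasCurveDeriv.map (hD k) L hL⟩

theorem hasCurveDeriv_iff_hasDerivAt {c c' : ℝ → ℂ} :
    HasCurveDeriv c c' ↔ ∀ t, HasDerivAt c (c' t) t := by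
  refine forall_congr' fun t => ?_
  rw [hasDerivAt_iff_tendsto_slope]
  refine iff_of_eq (congrArg (fun f => Tendsto f _ _) (funext fun τ => ?_))
  simp [slope_def_module]

theorem HasCurveDeriv.continuous [IsTopologicalAddGroup F] [ContinuousSMul ℂ F] {c c' : ℝ → F}
    (h : HasCurveDeriv c c') : Continuous c := by
  refine continuous_iff_continuousAt.2 fun t => continuousAt_iff_punctured_nhds.2 ?_
  have h1 : Tendsto (fun τ : ℝ => ((τ - t : ℝ) : ℂ)) (𝓝[≠] t) (𝓝 0) := by
    refine tendsto_nhdsWithin_of_tendsto_nhds ?_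
    have : Continuous fun τ : ℝ => ((τ - t : ℝ) : ℂ) := by fun_prop
    simpa using this.tendsto t
  have h2 := (h1.smul (h t)).add_const (c t)
  rw [zero_smul, zero_add] at h2
  refine h2.congr' ?_
  filter_upwards [self_mem_nhdsWithin] with τ hτ
  have : (τ - t) ≠ 0 := sub_ne_zero.2 hτ
  rw [smul_smul, ← Complex.ofReal_mul, mul_inv_cancel₀ this, Complex.ofReal_one, one_smul,
    sub_add_cancel]

theorem HasCurveDeriv.add [ContinuousAdd F] {c c' d d' : ℝ → F} (hc : HasCurveDeriv c c')
    (hd : HasCurveDeriv d d') :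
    HasCurveDeriv (fun t => c t + d t) (fun t => c' t + d' t) := fun t => by
  refine ((hc t).add (hd t)).congr fun τ => ?_
  rw [← smul_add, add_sub_add_comm]

theorem HasCurveDeriv.smul [IsTopologicalAddGroup F] [ContinuousSMul ℂ F] {a a' : ℝ → ℂ}
    {c c' : ℝ → F} (ha : HasCurveDeriv a a') (hc : HasCurveDeriv c c') :
    HasCurveDeriv (fun t => a t • c t) (fun t => a' t • c t + a t • c' t) := fun t => by
  have hct : Tendsto c (𝓝[≠] t) (𝓝 (c t)) :=
    tendsto_nhdsWithin_of_tendsto_nhds (hc.continuous.tendsto t)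
  -- The difference quotient splits as (quotient of `a`) • `c τ` + `a t` • (quotient of `c`), so
  -- continuity of `c` at `t` is needed.
  refine (((ha t).smul hct).add ((hc t).const_smul (a t))).congr fun τ => ?_
  simp only [smul_sub, sub_smul, smul_eq_mul, mul_smul, smul_comm (a t)]
  abel

theorem HasCurveDeriv.const_mul {A : Type*} [CommRing A] [Algebra ℂ A] [TopologicalSpace A]
    [ContinuousMul A] {c c' : ℝ → A} (f : A) (h : HasCurveDeriv c c') :
    HasCurveDeriv (fun t => f * c t) (fun t => f * c' t) := fun t => by
  refine ((h t).const_mul f).congr fun τ => ?_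
  rw [mul_smul_comm, mul_sub]

theorem mem_complexSmoothCurves_iff_contDiff {c : ℝ → ℂ} :
    c ∈ complexSmoothCurves ℂ ↔ ContDiff ℝ ∞ c := by
  constructor
  · intro hc
    rw [contDiff_infty]
    intro n
    induction n generalizing c with
    | zero =>
      obtain ⟨c', -, h⟩ := exists_hasCurveDeriv hc
      exact contDiff_zero.2 h.continuous
    | succ n ih =>
      obtain ⟨c', hc', h⟩ := exists_hasCurveDeriv hc
      rw [hasCurveDeriv_iff_hasDerivAt] at h
      push_cast
      refine contDiff_succ_iff_deriv.2 ⟨fun t => (h t).differentiableAt, by simp, ?_⟩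
      rw [show deriv c = c' from funext fun t => (h t).deriv]
      exact ih hc'
  · refine fun hc => mem_complexSmoothCurves_of_closed (S := {c | ContDiff ℝ ∞ c}) ?_ hc
    intro c hc
    rw [mem_ofPred_eq, contDiff_infty_iff_deriv] at hc
    exact ⟨deriv c, hc.2, hasCurveDeriv_iff_hasDerivAt.2 fun t => (hc.1 t).hasDerivAt⟩

/-- The time parameter of the homotopy is a curve in `ℝ`, which is not a complex vector space, so
the calculus of `HasCurveDeriv` does not cover it. -/
theorem mem_smoothCurves_real_iff_contDiff {c : ℝ → ℝ} :
    c ∈ smoothCurves ℝ ↔ ContDiff ℝ ∞ c := by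
  constructor
  · rintro ⟨D, rfl, hD⟩
    have hd : ∀ k t, HasDerivAt (D k) (D (k + 1) t) t := fun k t =>
      hasDerivAt_iff_tendsto_slope.2 (hD k t)
    have : ∀ n k : ℕ, ContDiff ℝ n (D k) := by
      intro n
      induction n with
      | zero =>
        exact fun k => contDiff_zero.2 (continuous_iff_continuousAt.2 fun t => (hd k t).continuousAt)
      | succ n ih =>
        intro k
        push_cast
        refine contDiff_succ_iff_deriv.2 ⟨fun t => (hd k t).differentiableAt, by simp, ?_⟩
        rw [show deriv (D k) = D (k + 1) from funext fun t => (hd k t).deriv]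
        exact ih (k + 1)
    exact contDiff_infty.2 fun n => this n 0
  · intro hc
    refine ⟨fun k => iteratedDeriv k c, iteratedDeriv_zero, fun k t => ?_⟩
    rw [← hasDerivAt_iff_tendsto_slope]
    beta_reduce
    rw [iteratedDeriv_succ]
    exact ((hc.differentiable_iteratedDeriv k (by exact_mod_cast WithTop.coe_lt_top _)) t).hasDerivAt

/-- A curve of matrices is smooth if and only if its entries are. -/
theorem mem_complexSmoothCurves_matrix {m n : Type*} {c : ℝ → Matrix m n F} :
    c ∈ complexSmoothCurves (Matrix m n F) ↔
      ∀ i j, (fun t => c t i j) ∈ complexSmoothCurves F := by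
  constructor
  · rintro ⟨D, rfl, hD⟩ i j
    refine ⟨fun k t => D k t i j, rfl, fun k t => ?_⟩
    exact tendsto_pi_nhds.1 (tendsto_pi_nhds.1 (hD k t) i) j
  · intro h
    choose D hD0 hD using h
    refine ⟨fun k t => Matrix.of fun i j => D i j k t, ?_, fun k t => ?_⟩
    · ext t i j
      exact congrFun (hD0 i j) t
    · exact tendsto_pi_nhds.2 fun i => tendsto_pi_nhds.2 fun j => hD i j k t

end Curves

/-! ### Holomorphic functions on the polydisc -/

instance {E : Type*} [NormedAddCommGroup E] [NormedSpace ℂ E] {X : Type*} [TopologicalSpace X]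
    [ChartedSpace E X] (B : TopologicalSpace.Opens X) :
    IsTopologicalAddGroup (holomorphicFunctions E B) :=
  inferInstanceAs (IsTopologicalAddGroup (Subalgebra.toSubmodule (holomorphicFunctions E B)))

section Polydisc

variable {d : ℕ}

variable (d) in
/-- The algebra of holomorphic functions on the unit polydisc. -/
noncomputable abbrev polydiscFunctions : Subalgebra ℂ C(unitPolydisc d, ℂ) :=
  holomorphicFunctions (Fin d → ℂ) (unitPolydisc d)

/-- The extension by zero of a function on the unit polydisc. -/
noncomputable def extendZero (f : polydiscFunctions d) : (Fin d → ℂ) → ℂ :=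
  Function.extend Subtype.val (fun z => f.1 z) 0

@[simp]
theorem extendZero_coe (f : polydiscFunctions d) (z : unitPolydisc d) :
    extendZero f z = f.1 z :=
  Subtype.val_injective.extend_apply _ _ _

theorem contMDiffAt_of_contDiffAt {f : unitPolydisc d → ℂ} {g : (Fin d → ℂ) → ℂ}
    {z : unitPolydisc d} (hg : ContDiffAt ℂ ω g z) (h : ∀ z : unitPolydisc d, g z = f z) :
    ContMDiffAt 𝓘(ℂ, Fin d → ℂ) 𝓘(ℂ) ω f z := by
  have := contMDiffAt_subtype_iff.2 hg.contMDiffAt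
  simpa only [h] using this

/-- Since the polydisc is open, values outside it do not affect germs inside, and calculus can take
place on `Fin d → ℂ`. -/
theorem contDiffAt_extendZero (f : polydiscFunctions d) {z : Fin d → ℂ}
    (hz : z ∈ unitPolydisc d) : ContDiffAt ℂ ω (extendZero f) z := by
  rw [← contMDiffAt_iff_contDiffAt, ← contMDiffAt_subtype_iff (x := ⟨z, hz⟩)]
  simpa only [extendZero_coe] using f.2 ⟨z, hz⟩

/-- A function that is analytic in a neighbourhood of each point of the polydisc restricts to a
holomorphic function on the polydisc. -/
noncomputable def restrictPolydisc (g : (Fin d → ℂ) → ℂ)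
    (hg : ∀ z ∈ unitPolydisc d, ContDiffAt ℂ ω g z) : polydiscFunctions d :=
  have h : ContMDiff 𝓘(ℂ, Fin d → ℂ) 𝓘(ℂ) ω fun z : unitPolydisc d => g z := fun z =>
    contMDiffAt_of_contDiffAt (hg z z.2) fun _ => rfl
  ⟨⟨fun z => g z, h.continuous⟩, h⟩

theorem differentiableAt_extendZero (f : polydiscFunctions d) {z : Fin d → ℂ}
    (hz : z ∈ unitPolydisc d) : DifferentiableAt ℂ (extendZero f) z :=
  (contDiffAt_extendZero f hz).differentiableAt (by simp)

theorem extendZero_add (f g : polydiscFunctions d) :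
    extendZero (f + g) = extendZero f + extendZero g := by
  ext z
  by_cases hz : z ∈ unitPolydisc d
  · lift z to unitPolydisc d using hz
    simp
  · have h : ¬ ∃ w : unitPolydisc d, (w : Fin d → ℂ) = z := fun ⟨w, hw⟩ => hz (hw ▸ w.2)
    simp [extendZero, Function.extend_apply' _ _ _ h]

theorem extendZero_smul (a : ℂ) (f : polydiscFunctions d) :
    extendZero (a • f) = a • extendZero f := by
  ext z
  by_cases hz : z ∈ unitPolydisc d
  · lift z to unitPolydisc d using hz
    simp
  · have h : ¬ ∃ w : unitPolydisc d, (w : Fin d → ℂ) = z := fun ⟨w, hw⟩ => hz (hw ▸ w.2)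
    simp [extendZero, Function.extend_apply' _ _ _ h]

/-- The derivative in the direction `v` of holomorphic functions on the polydisc. -/
noncomputable def polydiscDeriv (v : Fin d → ℂ) : polydiscFunctions d →ₗ[ℂ] polydiscFunctions d where
  toFun f := restrictPolydisc (fun z => fderiv ℂ (extendZero f) z v) fun _ hz =>
    ((contDiffAt_extendZero f hz).fderiv_right (by simp)).clm_apply contDiffAt_const
  map_add' f g := by
    ext z
    change fderiv ℂ (extendZero (f + g)) z v = fderiv ℂ (extendZero f) z v +
      fderiv ℂ (extendZero g) z v
    rw [extendZero_add, fderiv_add (differentiableAt_extendZero f z.2)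
      (differentiableAt_extendZero g z.2), add_apply]
  map_smul' a f := by
    ext z
    change fderiv ℂ (extendZero (a • f)) z v = a • fderiv ℂ (extendZero f) z v
    rw [extendZero_smul, fderiv_const_smul (differentiableAt_extendZero f z.2), smul_apply]

theorem polydiscDeriv_apply (v : Fin d → ℂ) (f : polydiscFunctions d) (z : unitPolydisc d) :
    (polydiscDeriv v f).1 z = fderiv ℂ (extendZero f) z v :=
  rfl

/-- Cauchy's estimate for the derivative in the direction `v`. -/
theorem norm_polydiscDeriv_le (v : Fin d → ℂ) (f : polydiscFunctions d) (z : unitPolydisc d)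
    {ρ ε : ℝ} (hρ : 0 < ρ)
    (h : ∀ a : ℂ, ‖a‖ ≤ ρ → ∃ hz : (z : Fin d → ℂ) + a • v ∈ unitPolydisc d,
      ‖f.1 ⟨(z : Fin d → ℂ) + a • v, hz⟩‖ ≤ ε) :
    ‖(polydiscDeriv v f).1 z‖ ≤ ε / ρ := by
  rw [polydiscDeriv_apply, ← (differentiableAt_extendZero f z.2).lineDeriv_eq_fderiv, lineDeriv]
  refine Complex.norm_deriv_le_of_forall_mem_sphere_norm_le hρ ?_ fun a ha => ?_
  · refine DifferentiableOn.diffContOnCl_ball (U := Metric.closedBall 0 ρ) ?_ subset_rfl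
    intro a ha
    rw [mem_closedBall_zero_iff] at ha
    have h1 := differentiableAt_extendZero f (h a ha).1
    have h2 : DifferentiableAt ℂ (fun a : ℂ => (z : Fin d → ℂ) + a • v) a := by fun_prop
    exact (h1.comp a h2).differentiableWithinAt
  · rw [mem_sphere_zero_iff_norm] at ha
    obtain ⟨hz, hf⟩ := h a ha.le
    rwa [show extendZero f (↑z + a • v) = _ from extendZero_coe f ⟨_, hz⟩]

instance : LocallyCompactSpace (unitPolydisc d) :=
  (unitPolydisc d).isOpen.locallyCompactSpace

/-- By Cauchy's estimate, the derivative of `f - f₀` near `z₀` is controlled by the supremum of `f -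
f₀` on a compact neighbourhood. Joint continuity in `(f, z)` follows by splitting `f = (f - f₀) +
f₀`, and currying gives the compact-open topology. -/
theorem continuous_polydiscDeriv (v : Fin d → ℂ) :
    Continuous (polydiscDeriv v : polydiscFunctions d → polydiscFunctions d) := by
  refine continuous_induced_rng.2 (ContinuousMap.continuous_of_continuous_uncurry _ ?_)
  refine continuous_iff_continuousAt.2 fun ⟨f₀, z₀⟩ => ?_
  obtain ⟨R, hR, hball⟩ := Metric.isOpen_iff.1 (unitPolydisc d).isOpen z₀ z₀.2
  -- For `z` within `r` of `z₀`, the disc `z + a • v` with `‖a‖ ≤ ρ` stays in the compact ball of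
  -- radius `2r` inside the polydisc. The `+ 1` in `ρ` covers `v = 0`.
  obtain ⟨r, hr, hrR⟩ : ∃ r : ℝ, 0 < r ∧ r + r < R := ⟨R / 3, by positivity, by linarith⟩
  obtain ⟨ρ, hρ, hρv⟩ : ∃ ρ : ℝ, 0 < ρ ∧ ρ * ‖v‖ ≤ r :=
    ⟨r / (‖v‖ + 1), by positivity, by
      rw [div_mul_eq_mul_div, div_le_iff₀ (by positivity)]
      nlinarith [norm_nonneg v]⟩
  have hsub : Metric.closedBall (z₀ : Fin d → ℂ) (r + r) ⊆ unitPolydisc d :=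
    (Metric.closedBall_subset_ball hrR).trans hball
  set K : Set (unitPolydisc d) := Subtype.val ⁻¹' Metric.closedBall (z₀ : Fin d → ℂ) (r + r)
  have hK : IsCompact K := (Topology.IsInducing.subtypeVal.isCompact_preimage_iff
    (by simpa using hsub)).2 (isCompact_closedBall _ _)
  have hcts : ContinuousAt (fun p : polydiscFunctions d × unitPolydisc d =>
      (polydiscDeriv v f₀).1 p.2) (f₀, z₀) := by fun_prop
  have key : Tendsto (fun p : polydiscFunctions d × unitPolydisc d =>
      (polydiscDeriv v (p.1 - f₀)).1 p.2) (𝓝 (f₀, z₀)) (𝓝 0) := by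
    rw [Metric.tendsto_nhds]
    intro ε hε
    have hf : ∀ᶠ f : polydiscFunctions d in 𝓝 f₀, ∀ z ∈ K, dist (f₀.1 z) (f.1 z) < ε * ρ / 2 :=
      Metric.tendstoUniformlyOn_iff.1 (ContinuousMap.tendsto_iff_forall_isCompact_tendstoUniformlyOn.1
        (continuous_subtype_val.tendsto f₀) K hK) _ (by positivity)
    have hz : ∀ᶠ z : unitPolydisc d in 𝓝 z₀, dist (z : Fin d → ℂ) z₀ < r :=
      Metric.ball_mem_nhds z₀ hr
    rw [nhds_prod_eq]
    filter_upwards [hf.prod_mk hz] with ⟨f, z⟩ ⟨hf, hz⟩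
    rw [dist_zero_right]
    refine (norm_polydiscDeriv_le v _ z hρ (ε := ε * ρ / 2) fun a ha => ?_).trans_lt ?_
    · have hmem : (z : Fin d → ℂ) + a • v ∈ Metric.closedBall (z₀ : Fin d → ℂ) (r + r) := by
        rw [Metric.mem_closedBall]
        refine (dist_triangle _ (z : Fin d → ℂ) _).trans (add_le_add ?_ hz.le)
        rw [dist_eq_norm, add_sub_cancel_left, norm_smul]
        exact (mul_le_mul_of_nonneg_right ha (norm_nonneg v)).trans hρv
      refine ⟨hsub hmem, ?_⟩
      have := hf ⟨_, hsub hmem⟩ hmem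
      rw [dist_comm, dist_eq_norm] at this
      exact this.le
    · rw [div_lt_iff₀ hρ]
      nlinarith [mul_pos hε hρ]
  have := key.add hcts.tendsto
  rw [zero_add] at this
  refine this.congr fun p => ?_
  have h : polydiscDeriv v p.1 = polydiscDeriv v (p.1 - f₀) + polydiscDeriv v f₀ := by
    rw [← map_add]
    exact congrArg _ (sub_add_cancel p.1 f₀).symm
  exact (congrArg (fun f : polydiscFunctions d => f.1 p.2) h).symm

/-- Evaluation at a point of the polydisc. -/
noncomputable def polydiscEval (z : unitPolydisc d) : polydiscFunctions d →ₗ[ℂ] ℂ where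
  toFun f := f.1 z
  map_add' _ _ := rfl
  map_smul' _ _ := rfl

theorem continuous_polydiscEval (z : unitPolydisc d) :
    Continuous (polydiscEval z : polydiscFunctions d → ℂ) :=
  by
  change Continuous fun f : polydiscFunctions d => f.1 z
  fun_prop

theorem continuous_smoothCurve {c : ℝ → polydiscFunctions d}
    (hc : c ∈ complexSmoothCurves (polydiscFunctions d)) : Continuous c :=
  have ⟨_, _, h⟩ := exists_hasCurveDeriv hc
  h.continuous

theorem continuousAt_extendZero {c : ℝ → polydiscFunctions d} (hc : Continuous c) (τ : ℝ)
    (z : unitPolydisc d) :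
    ContinuousAt (fun p : ℝ × (Fin d → ℂ) => extendZero (c p.1) p.2) (τ, z) := by
  have he : Topology.IsOpenEmbedding (Prod.map id Subtype.val : ℝ × unitPolydisc d → _) :=
    Topology.IsOpenEmbedding.id.prodMap (unitPolydisc d).isOpen.isOpenEmbedding_subtypeVal
  have h := he.continuousAt_iff (g := fun p : ℝ × (Fin d → ℂ) => extendZero (c p.1) p.2)
    (x := (τ, z))
  refine h.1 (Continuous.continuousAt ?_)
  simp only [Function.comp_def, Prod.map_fst, Prod.map_snd, id_eq, extendZero_coe]
  fun_prop

/-- Expressing the differential through coordinate derivatives reduces its continuity along a curve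
to `continuous_polydiscDeriv`. -/
theorem fderiv_extendZero (f : polydiscFunctions d) {z : Fin d → ℂ} (hz : z ∈ unitPolydisc d) :
    fderiv ℂ (extendZero f) z = ∑ i, extendZero (polydiscDeriv (Pi.single i 1) f) z •
      (ContinuousLinearMap.proj i : (Fin d → ℂ) →L[ℂ] ℂ) := by
  lift z to unitPolydisc d using hz
  ext v
  rw [← ContinuousLinearMap.coe_coe, LinearMap.pi_apply_eq_sum_univ]
  have hs : ∀ i, (fun j => if i = j then (1 : ℂ) else 0) = (Pi.single i 1 : Fin d → ℂ) :=
    fun i => funext fun j => by simp [Pi.single_apply, eq_comm]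
  simp [polydiscDeriv_apply, mul_comm, hs]

/-- A smooth curve of holomorphic functions on the polydisc is strictly differentiable as a
function of the parameter and the point. -/
theorem hasStrictFDerivAt_extendZero {c c' : ℝ → polydiscFunctions d}
    (hc : c ∈ complexSmoothCurves (polydiscFunctions d))
    (hc' : c' ∈ complexSmoothCurves (polydiscFunctions d)) (h : HasCurveDeriv c c') (τ : ℝ)
    (z : unitPolydisc d) :
    HasStrictFDerivAt (fun p : ℝ × (Fin d → ℂ) => extendZero (c p.1) p.2)
      (((1 : ℝ →L[ℝ] ℝ).smulRight (extendZero (c' τ) z)).coprod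
        (∑ i, extendZero (polydiscDeriv (Pi.single i 1) (c τ)) z •
          (ContinuousLinearMap.proj i : (Fin d → ℂ) →L[ℂ] ℂ).restrictScalars ℝ)) (τ, z) := by
  have hP : ∀ᶠ p : ℝ × (Fin d → ℂ) in 𝓝 (τ, (z : Fin d → ℂ)), p.2 ∈ unitPolydisc d :=
    continuous_snd.continuousAt.eventually ((unitPolydisc d).isOpen.mem_nhds z.2)
  -- The partial derivatives in the parameter and in the point exist nearby and are jointly
  -- continuous, which yields strict differentiability.
  let f₁ : ℝ → (Fin d → ℂ) → ℝ →L[ℝ] ℂ := fun τ z =>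
    (1 : ℝ →L[ℝ] ℝ).smulRight (extendZero (c' τ) z)
  let f₂ : ℝ → (Fin d → ℂ) → (Fin d → ℂ) →L[ℝ] ℂ := fun τ z =>
    ∑ i, extendZero (polydiscDeriv (Pi.single i 1) (c τ)) z •
      (ContinuousLinearMap.proj i : (Fin d → ℂ) →L[ℂ] ℂ).restrictScalars ℝ
  have df₁ : ∀ᶠ p : ℝ × (Fin d → ℂ) in 𝓝 (τ, (z : Fin d → ℂ)),
      HasFDerivAt (fun t => extendZero (c t) p.2) (f₁ p.1 p.2) p.1 := by
    filter_upwards [hP] with ⟨t, w⟩ hw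
    have := hasCurveDeriv_iff_hasDerivAt.1
      (h.map (polydiscEval ⟨w, hw⟩) (continuous_polydiscEval ⟨w, hw⟩)) t
    simp only [polydiscEval, LinearMap.coe_mk, AddHom.coe_mk, ← extendZero_coe] at this
    exact this.hasFDerivAt
  have df₂ : ∀ᶠ p : ℝ × (Fin d → ℂ) in 𝓝 (τ, (z : Fin d → ℂ)),
      HasFDerivAt (fun w => extendZero (c p.1) w) (f₂ p.1 p.2) p.2 := by
    filter_upwards [hP] with ⟨t, w⟩ hw
    have := (differentiableAt_extendZero (c t) hw).hasFDerivAt.restrictScalars ℝ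
    rw [fderiv_extendZero _ hw] at this
    refine this.congr_fderiv ?_
    ext v
    simp [f₂]
  have cf₁ : ContinuousAt (fun p : ℝ × (Fin d → ℂ) => f₁ p.1 p.2) (τ, (z : Fin d → ℂ)) := by
    have h1 := continuousAt_extendZero (continuous_smoothCurve hc') τ z
    exact ((ContinuousLinearMap.smulRightL ℝ ℝ ℂ 1).continuous.continuousAt).comp h1
  have cf₂ : ContinuousAt (fun p : ℝ × (Fin d → ℂ) => f₂ p.1 p.2) (τ, (z : Fin d → ℂ)) := by
    refine tendsto_finsetSum _ fun i _ => Tendsto.smul_const ?_ _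
    exact continuousAt_extendZero (c := fun t => polydiscDeriv (Pi.single i 1) (c t))
      ((continuous_polydiscDeriv _).comp (continuous_smoothCurve hc)) τ z
  exact hasStrictFDerivAt_uncurry_coprod (u := (τ, (z : Fin d → ℂ)))
    (f := fun τ z => extendZero (c τ) z) (f₁ := f₁) (f₂ := f₂) df₁ df₂ cf₁ cf₂

/-- A curve of holomorphic functions on the polydisc is differentiable if it is strictly
differentiable as a function of the parameter and the point. -/
theorem hasCurveDeriv_of_hasStrictFDerivAt {γ δ : ℝ → polydiscFunctions d}
    {F : ℝ × (Fin d → ℂ) → ℂ} (hF : ∀ (τ : ℝ) (z : unitPolydisc d), F (τ, z) = (γ τ).1 z)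
    (h : ∀ (τ : ℝ) (z : unitPolydisc d), ∃ A : ℝ × (Fin d → ℂ) →L[ℝ] ℂ,
      HasStrictFDerivAt F A (τ, z) ∧ A (1, 0) = (δ τ).1 z) : HasCurveDeriv γ δ := by
  intro t
  -- Convergence in the function algebra is locally uniform convergence, tested at each `z` along
  -- the product filter of times and points.
  rw [Topology.IsInducing.subtypeVal.tendsto_nhds_iff,
    ContinuousMap.tendsto_iff_tendstoLocallyUniformly,
    tendstoLocallyUniformly_iff_forall_tendsto]
  intro z
  obtain ⟨A, hA, hAδ⟩ := h t z
  have h1 : Tendsto (fun p : ℝ × unitPolydisc d => (δ t).1 p.2) (𝓝[≠] t ×ˢ 𝓝 z)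
      (𝓝 ((δ t).1 z)) := ((δ t).1.continuous.tendsto z).comp tendsto_snd
  have h2 : Tendsto (fun p : ℝ × unitPolydisc d =>
      (((p.1 - t)⁻¹ : ℝ) : ℂ) • ((γ p.1).1 p.2 - (γ t).1 p.2)) (𝓝[≠] t ×ˢ 𝓝 z)
      (𝓝 ((δ t).1 z)) := by
    have hle : 𝓝[≠] t ×ˢ 𝓝 z ≤ 𝓝 t ×ˢ 𝓝 z := Filter.prod_mono_left _ nhdsWithin_le_nhds
    have hx : Tendsto (fun p : ℝ × unitPolydisc d =>
        (((p.1, (p.2 : Fin d → ℂ)), (t, (p.2 : Fin d → ℂ))) :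
          (ℝ × (Fin d → ℂ)) × (ℝ × (Fin d → ℂ)))) (𝓝[≠] t ×ˢ 𝓝 z)
        (𝓝 ((t, (z : Fin d → ℂ)), (t, (z : Fin d → ℂ)))) := by
      refine Tendsto.mono_left ?_ hle
      rw [← nhds_prod_eq]
      exact Continuous.tendsto' (by fun_prop) _ _ rfl
    -- Both points `(τ, w)` and `(t, w)` move with `w`, so plain differentiability at `(t, z)` would
    -- not suffice.
    have ho := (hasStrictFDerivAt_iff_isLittleO.1 hA).comp_tendsto hx
    have ho' : (fun p : ℝ × unitPolydisc d => F (p.1, p.2) - F (t, p.2) -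
        A ((p.1, (p.2 : Fin d → ℂ)) - (t, (p.2 : Fin d → ℂ))))
        =o[𝓝[≠] t ×ˢ 𝓝 z] fun p => p.1 - t := by
      exact ho.trans_isBigO (Asymptotics.isBigO_of_le _ fun p => by simp)
    have hz := ho'.tendsto_inv_smul_nhds_zero.add_const ((δ t).1 z)
    rw [zero_add] at hz
    refine hz.congr' ?_
    have hne : ∀ᶠ p : ℝ × unitPolydisc d in 𝓝[≠] t ×ˢ 𝓝 z, p.1 ≠ t :=
      (eventually_mem_nhdsWithin (s := {t}ᶜ)).prod_inl _
    filter_upwards [hne] with p hp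
    have hp' : p.1 - t ≠ 0 := sub_ne_zero.2 hp
    have hAp : A ((p.1, (p.2 : Fin d → ℂ)) - (t, (p.2 : Fin d → ℂ))) = (p.1 - t) • (δ t).1 z := by
      rw [← hAδ, ← map_smul]
      simp
    rw [hAp, smul_sub, smul_smul, inv_mul_cancel₀ hp', one_smul, sub_add_cancel, hF, hF]
    simp
  exact (h1.prodMk_nhds h2).mono_right (nhds_le_uniformity _)

/-! ### Dilations of the polydisc -/

theorem smul_mem_unitPolydisc (s : unitInterval) {z : Fin d → ℂ} (hz : z ∈ unitPolydisc d) :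
    (s : ℝ) • z ∈ unitPolydisc d := fun i => by
  rw [Pi.smul_apply, norm_smul, Real.norm_of_nonneg s.2.1]
  exact (mul_le_of_le_one_left (norm_nonneg _) s.2.2).trans_lt (hz i)

/-- The dilation of the polydisc by a factor in the unit interval. -/
noncomputable def polydiscScale (s : unitInterval) (z : unitPolydisc d) : unitPolydisc d :=
  ⟨(s : ℝ) • (z : Fin d → ℂ), smul_mem_unitPolydisc s z.2⟩

/-- The function `z ↦ f (s z)`. -/
noncomputable def dilateFunction (s : unitInterval) (f : polydiscFunctions d) :
    polydiscFunctions d :=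
  restrictPolydisc (fun z => extendZero f ((s : ℝ) • z)) fun z hz => by
    have h := contDiffAt_extendZero f (smul_mem_unitPolydisc s hz)
    exact h.comp z (contDiffAt_id.const_smul (s : ℝ))

theorem dilateFunction_apply (s : unitInterval) (f : polydiscFunctions d) (z : unitPolydisc d) :
    (dilateFunction s f).1 z = f.1 (polydiscScale s z) :=
  extendZero_coe f (polydiscScale s z)

/-- The algebra endomorphism `f ↦ f (s ·)` of the functions on the polydisc. -/
noncomputable def dilate (s : unitInterval) : polydiscFunctions d →ₐ[ℂ] polydiscFunctions d where
  toFun := dilateFunction s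
  map_one' := by ext z; simp only [dilateFunction_apply]; rfl
  map_mul' f g := by
    ext z
    change (dilateFunction s (f * g)).1 z =
      (dilateFunction s f).1 z * (dilateFunction s g).1 z
    simp only [dilateFunction_apply]; rfl
  map_zero' := by ext z; simp only [dilateFunction_apply]; rfl
  map_add' f g := by
    ext z
    change (dilateFunction s (f + g)).1 z =
      (dilateFunction s f).1 z + (dilateFunction s g).1 z
    simp only [dilateFunction_apply]; rfl
  commutes' a := by ext z; simp only [dilateFunction_apply]; rfl

theorem dilate_apply (s : unitInterval) (f : polydiscFunctions d) (z : unitPolydisc d) :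
    (dilate s f).1 z = f.1 (polydiscScale s z) :=
  dilateFunction_apply s f z

theorem dilate_one : dilate 1 = AlgHom.id ℂ (polydiscFunctions d) := by
  ext f z
  refine (dilate_apply 1 f z).trans ?_
  rw [show polydiscScale 1 z = z from Subtype.ext (by simp [polydiscScale])]
  rfl

variable (d) in
/-- The centre of the polydisc. -/
def polydiscCentre : unitPolydisc d := ⟨0, fun i => by simp⟩

theorem dilate_zero (f : polydiscFunctions d) :
    dilate 0 f = algebraMap ℂ (polydiscFunctions d) (f.1 (polydiscCentre d)) := by
  ext z
  refine (dilate_apply 0 f z).trans ?_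
  rw [show polydiscScale 0 z = polydiscCentre d from
    Subtype.ext (by simp [polydiscScale, polydiscCentre])]
  rfl

/-- The coordinate functions on the polydisc. -/
noncomputable def polydiscCoord (i : Fin d) : polydiscFunctions d :=
  restrictPolydisc (fun z => z i) fun _ _ =>
    (ContinuousLinearMap.proj i : (Fin d → ℂ) →L[ℂ] ℂ).contDiff.contDiffAt

/-- The curves generated by the dilations of smooth curves by a variable factor `φ` under addition
and multiplication by smooth scalars and by fixed functions. -/
inductive IsDilationCurve (φ : ℝ → unitInterval) : (ℝ → polydiscFunctions d) → Prop
  | dilate {c : ℝ → polydiscFunctions d} (hc : c ∈ complexSmoothCurves (polydiscFunctions d)) :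
      IsDilationCurve φ fun t => dilate (φ t) (c t)
  | zero : IsDilationCurve φ fun _ => 0
  | add {c c' : ℝ → polydiscFunctions d} (hc : IsDilationCurve φ c) (hc' : IsDilationCurve φ c') :
      IsDilationCurve φ fun t => c t + c' t
  | smul {a : ℝ → ℂ} {c : ℝ → polydiscFunctions d} (ha : ContDiff ℝ ∞ a)
      (hc : IsDilationCurve φ c) : IsDilationCurve φ fun t => a t • c t
  | mul (f : polydiscFunctions d) {c : ℝ → polydiscFunctions d} (hc : IsDilationCurve φ c) :
      IsDilationCurve φ fun t => f * c t

theorem IsDilationCurve.sum {φ : ℝ → unitInterval} {ι : Type*} (s : Finset ι)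
    {c : ι → ℝ → polydiscFunctions d} (hc : ∀ i, IsDilationCurve φ (c i)) :
    IsDilationCurve φ fun t => ∑ i ∈ s, c i t := by
  classical
  induction s using Finset.induction_on with
  | empty => simpa using IsDilationCurve.zero
  | insert i s hi ih =>
    simp only [Finset.sum_insert hi]
    exact (hc i).add ih

/-- This is the chain rule for `c t (φ t • z)`: the moving dilation factor contributes `φ'(t) ∑ zᵢ
(∂ᵢ c t)(φ t • z)`. -/
theorem hasCurveDeriv_dilate {φ : ℝ → unitInterval} (hφ : ContDiff ℝ ∞ fun t => (φ t : ℝ))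
    {c c' : ℝ → polydiscFunctions d} (hc : c ∈ complexSmoothCurves (polydiscFunctions d))
    (hc' : c' ∈ complexSmoothCurves (polydiscFunctions d)) (h : HasCurveDeriv c c') :
    HasCurveDeriv (fun t => dilate (φ t) (c t)) fun t => dilate (φ t) (c' t) +
      ((deriv (fun t => (φ t : ℝ)) t : ℝ) : ℂ) •
        ∑ i, polydiscCoord i * dilate (φ t) (polydiscDeriv (Pi.single i 1) (c t)) := by
  refine hasCurveDeriv_of_hasStrictFDerivAt
    (F := fun p => extendZero (c p.1) ((φ p.1 : ℝ) • p.2))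
    (fun τ z => (extendZero_coe _ (polydiscScale (φ τ) z)).trans (dilate_apply _ _ _).symm)
    fun τ z => ?_
  have h1 := hasStrictFDerivAt_extendZero hc hc' h τ (polydiscScale (φ τ) z)
  have hφτ : HasStrictDerivAt (fun t => (φ t : ℝ)) (deriv (fun t => (φ t : ℝ)) τ) τ :=
    hφ.contDiffAt.hasStrictDerivAt (by simp)
  have h2 : HasStrictFDerivAt (fun p : ℝ × (Fin d → ℂ) => (φ p.1 : ℝ)) _ (τ, (z : Fin d → ℂ)) :=
    HasStrictFDerivAt.comp (g := fun t => (φ t : ℝ)) (f := Prod.fst) (τ, (z : Fin d → ℂ))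
      hφτ.hasStrictFDerivAt (hasStrictFDerivAt_fst (𝕜 := ℝ) (p := (τ, (z : Fin d → ℂ))))
  have h3 := (hasStrictFDerivAt_fst (𝕜 := ℝ) (p := (τ, (z : Fin d → ℂ)))).prodMk
    (h2.smul (hasStrictFDerivAt_snd (p := (τ, (z : Fin d → ℂ)))))
  refine ⟨_, HasStrictFDerivAt.comp (τ, (z : Fin d → ℂ)) h1 h3, ?_⟩
  have hcoord : ∀ i, polydiscEval z (polydiscCoord i) = (z : Fin d → ℂ) i := fun _ => rfl
  have hmul : ∀ f g : polydiscFunctions d,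
      polydiscEval z (f * g) = polydiscEval z f * polydiscEval z g := fun _ _ => rfl
  have heval : ∀ f : polydiscFunctions d,
      polydiscEval z (dilate (φ τ) f) = f.1 (polydiscScale (φ τ) z) := fun f => dilate_apply _ f z
  have hev : ∀ f : polydiscFunctions d, polydiscEval z f = f.1 z := fun _ => rfl
  refine Eq.trans ?_ (hev _)
  rw [map_add, map_smul, map_sum]
  simp only [hmul, hcoord, heval, ← extendZero_coe]
  simp [Finset.mul_sum]
  exact Finset.sum_congr rfl fun i _ => by ring

theorem complexSmoothCurves_polydiscDeriv {c : ℝ → polydiscFunctions d}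
    (hc : c ∈ complexSmoothCurves (polydiscFunctions d)) (v : Fin d → ℂ) :
    (fun t => polydiscDeriv v (c t)) ∈ complexSmoothCurves (polydiscFunctions d) :=
  complexSmoothCurves_map (F := polydiscFunctions d) (G := polydiscFunctions d) hc (polydiscDeriv v)
    (continuous_polydiscDeriv v)

/-- Every term in the derivative of a generator is a dilated smooth curve times a fixed function or
a smooth scalar, and the Leibniz rule handles the remaining operations. -/
theorem IsDilationCurve.exists_hasCurveDeriv {φ : ℝ → unitInterval}
    (hφ : ContDiff ℝ ∞ fun t => (φ t : ℝ)) {c : ℝ → polydiscFunctions d}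
    (hc : IsDilationCurve φ c) : ∃ c', IsDilationCurve φ c' ∧ HasCurveDeriv c c' := by
  induction hc with
  | @dilate c hc =>
    obtain ⟨c', hc', h⟩ := _root_.exists_hasCurveDeriv hc
    have ha : ContDiff ℝ ∞ fun t => ((deriv (fun t => (φ t : ℝ)) t : ℝ) : ℂ) :=
      Complex.ofRealCLM.contDiff.comp (contDiff_infty_iff_deriv.1 hφ).2
    have hs : IsDilationCurve φ fun t => ∑ i, polydiscCoord i *
        _root_.dilate (φ t) (polydiscDeriv (Pi.single i 1) (c t)) :=
      IsDilationCurve.sum _ fun i => .mul _ (.dilate (complexSmoothCurves_polydiscDeriv hc _))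
    exact ⟨_, (IsDilationCurve.dilate hc').add (hs.smul ha), hasCurveDeriv_dilate hφ hc hc' h⟩
  | zero => exact ⟨_, .zero, fun t => by simp⟩
  | add _ _ ih ih' =>
    obtain ⟨e, he, h⟩ := ih
    obtain ⟨e', he', h'⟩ := ih'
    exact ⟨_, he.add he', h.add h'⟩
  | @smul a c ha hc ih =>
    obtain ⟨e, he, h⟩ := ih
    have ha' := contDiff_infty_iff_deriv.1 ha
    exact ⟨_, (hc.smul ha'.2).add (he.smul ha),
      (hasCurveDeriv_iff_hasDerivAt.2 fun t => (ha'.1 t).hasDerivAt).smul h⟩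
  | mul f _ ih =>
    obtain ⟨e, he, h⟩ := ih
    exact ⟨fun t => f * e t, he.mul f, HasCurveDeriv.const_mul (A := polydiscFunctions d) f h⟩

theorem IsDilationCurve.mem_complexSmoothCurves {φ : ℝ → unitInterval}
    (hφ : ContDiff ℝ ∞ fun t => (φ t : ℝ)) {c : ℝ → polydiscFunctions d}
    (hc : IsDilationCurve φ c) : c ∈ complexSmoothCurves (polydiscFunctions d) :=
  mem_complexSmoothCurves_of_closed (S := {c | IsDilationCurve φ c})
    (fun _ h => h.exists_hasCurveDeriv hφ) hc

end Polydisc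

/-! ### Smoothness of the polar decomposition -/

section PolarDecomposition

open scoped Matrix.Norms.L2Operator MatrixOrder ComplexOrder

variable {n : Type*} [Fintype n] [DecidableEq n]

/-- If `S` is positive definite, the Sylvester equation `SH + HS = 0` has only the trivial
solution. -/
theorem Matrix.PosDef.eq_zero_of_sylvester {S H : Matrix n n ℂ} (hS : S.PosDef)
    (h : S * H + H * S = 0) : H = 0 := by
  -- The sum is the trace of `H* (SH + HS)`. Both summands are nonnegative, so both vanish.
  have h1 : (H.conjTranspose * S * H).trace + (H * S * H.conjTranspose).trace = 0 := by
    rw [Matrix.trace_mul_comm (H * S), ← Matrix.trace_add, Matrix.mul_assoc, ← Matrix.mul_add, h,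
      Matrix.mul_zero, Matrix.trace_zero]
  have h2 := hS.posSemidef.conjTranspose_mul_mul_same H
  have h3 := hS.posSemidef.mul_mul_conjTranspose_same H
  have h4 : (H.conjTranspose * S * H).trace = 0 := by
    refine le_antisymm ?_ h2.trace_nonneg
    rw [eq_neg_of_add_eq_zero_left h1]
    exact neg_nonpos.2 h3.trace_nonneg
  have h5 : H.conjTranspose * S * H = 0 := h2.trace_eq_zero_iff.1 h4
  by_contra hH
  obtain ⟨v, hv⟩ : ∃ v, H.mulVec v ≠ 0 := by
    by_contra! hc
    exact hH (Matrix.ext_of_mulVec_single fun i => by rw [hc, Matrix.zero_mulVec])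
  have h6 := hS.dotProduct_mulVec_pos hv
  rw [Matrix.star_mulVec, ← Matrix.dotProduct_mulVec, Matrix.mulVec_mulVec, Matrix.mulVec_mulVec,
    h5] at h6
  simp at h6

/-- The derivative `H ↦ SH + HS` of the squaring map at a positive definite matrix `S`. -/
noncomputable def sylvesterEquiv {S : Matrix n n ℂ} (hS : S.PosDef) :
    Matrix n n ℂ ≃L[ℝ] Matrix n n ℂ :=
  (LinearEquiv.ofInjectiveEndo (LinearMap.mulLeft ℝ S + LinearMap.mulRight ℝ S)
    ((injective_iff_map_eq_zero _).2 fun _ h =>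
      hS.eq_zero_of_sylvester h)).toContinuousLinearEquiv

theorem hasFDerivAt_mul_self_sylvesterEquiv {S : Matrix n n ℂ} (hS : S.PosDef) :
    HasFDerivAt (fun T : Matrix n n ℂ => T * T)
      (sylvesterEquiv hS : Matrix n n ℂ →L[ℝ] Matrix n n ℂ) S := by
  convert! (hasFDerivAt_id (𝕜 := ℝ) S).mul' (hasFDerivAt_id S) using 1

/-- Positivity is automatic, and `|a|` is invertible because its square `a* a` is. -/
theorem posDef_cfcAbs {a : Matrix n n ℂ} (ha : IsUnit a) : (CFC.abs a).PosDef := by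
  rw [(Matrix.nonneg_iff_posSemidef.1 (CFC.abs_nonneg a)).posDef_iff_isUnit]
  have : IsUnit (CFC.abs a * CFC.abs a) := by
    rw [CFC.abs_mul_abs]
    exact ha.star.mul ha
  exact ((Commute.refl _).isUnit_mul_iff.1 this).1

theorem continuous_cfcAbs : Continuous (CFC.abs : Matrix n n ℂ → Matrix n n ℂ) :=
  CFC.continuousOn_sqrt.comp_continuous (by fun_prop) fun a => star_mul_self_nonneg a

/-- The absolute value `|a| = (a* a)^{1/2}` is a smooth function of the invertible matrix `a`. -/
theorem contDiffAt_cfcAbs {a : Matrix n n ℂ} (ha : IsUnit a) :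
    ContDiffAt ℝ ∞ (CFC.abs : Matrix n n ℂ → Matrix n n ℂ) a := by
  have hsq : ContDiffAt ℝ ∞ (fun T : Matrix n n ℂ => T * T) (CFC.abs a) := by fun_prop
  have hd := hasFDerivAt_mul_self_sylvesterEquiv (posDef_cfcAbs ha)
  have hinv := hsq.to_localInverse hd (by simp)
  have hstar : ContDiff ℝ ∞ (fun T : Matrix n n ℂ => star T * T) :=
    (starL' ℝ : Matrix n n ℂ ≃L[ℝ] Matrix n n ℂ).contDiff.mul contDiff_id
  rw [CFC.abs_mul_abs] at hinv
  refine (hinv.comp (f := fun T : Matrix n n ℂ => star T * T) a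
    hstar.contDiffAt).congr_of_eventuallyEq ?_
  -- The local inverse of squaring must return `|T|` and not another square root of `T* T`;
  -- continuity of the absolute value keeps `|T|` in the neighbourhood of `|a|` where it is a left
  -- inverse.
  filter_upwards [continuous_cfcAbs.continuousAt.eventually
    (hsq.hasStrictFDerivAt' hd (by simp)).eventually_left_inverse] with T hT
  rw [CFC.abs_mul_abs] at hT
  exact hT.symm

theorem contDiffAt_inv_cfcAbs {a : Matrix n n ℂ} (ha : IsUnit a) :
    ContDiffAt ℝ ∞ (fun T : Matrix n n ℂ => (CFC.abs T)⁻¹) a := by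
  obtain ⟨u, hu⟩ := (posDef_cfcAbs ha).isUnit
  have h := contDiffAt_ringInverse (n := ∞) ℝ u
  rw [hu] at h
  simpa only [Function.comp_def, Matrix.nonsing_inv_eq_ringInverse] using
    h.comp a (contDiffAt_cfcAbs ha)

/-- The entries of `|a|⁻¹` depend smoothly on those of the invertible matrix `a`. -/
theorem contDiff_inv_cfcAbs_apply {a : ℝ → Matrix n n ℂ} (hu : ∀ t, IsUnit (a t))
    (ha : ∀ i j, ContDiff ℝ ∞ fun t => a t i j) (i j : n) :
    ContDiff ℝ ∞ fun t => (CFC.abs (a t))⁻¹ i j := by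
  have h1 : ContDiff ℝ ∞ a := by
    have : a = fun t => ∑ i, ∑ j, a t i j • Matrix.single i j (1 : ℂ) := by
      funext t
      conv_lhs => rw [Matrix.matrix_eq_sum_single (a t)]
      simp
    rw [this]
    exact ContDiff.sum fun i _ => ContDiff.sum fun j _ => (ha i j).smul contDiff_const
  have h2 : ContDiff ℝ ∞ fun t => (CFC.abs (a t))⁻¹ := contDiff_iff_contDiffAt.2 fun t =>
    (contDiffAt_inv_cfcAbs (hu t)).comp t h1.contDiffAt
  exact (Matrix.entryLinearMap ℝ ℂ i j).toContinuousLinearMap.contDiff.comp h2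

/-- The absolute value depends only on `a* a`, in which `u` cancels; this is the source of
equivariance. -/
theorem cfcAbs_unitary_mul (u : Matrix.unitaryGroup n ℂ) (a : Matrix n n ℂ) :
    CFC.abs ((u : Matrix n n ℂ) * a) = CFC.abs a := by
  rw [CFC.abs, CFC.abs, star_mul, mul_assoc, ← mul_assoc (star (u : Matrix n n ℂ)),
    Unitary.coe_star_mul_self, one_mul]

theorem mul_inv_cfcAbs_mem_unitaryGroup {a : Matrix n n ℂ} (ha : IsUnit a) :
    a * (CFC.abs a)⁻¹ ∈ Matrix.unitaryGroup n ℂ := by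
  have hp := posDef_cfcAbs ha
  have hdet := (Matrix.isUnit_iff_isUnit_det _).1 hp.isUnit
  have hs : star (CFC.abs a)⁻¹ = (CFC.abs a)⁻¹ := hp.isHermitian.inv
  rw [Matrix.mem_unitaryGroup_iff', star_mul, hs, mul_assoc, ← mul_assoc (star a),
    ← CFC.abs_mul_abs, mul_assoc, Matrix.mul_nonsing_inv _ hdet, mul_one,
    Matrix.nonsing_inv_mul _ hdet]

/-- The segment from `|a|⁻¹` to `1`. -/
noncomputable def polarSegment (s : ℝ) (a : Matrix n n ℂ) : Matrix n n ℂ :=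
  ((1 - s : ℝ) : ℂ) • (CFC.abs a)⁻¹ + (s : ℂ) • 1

theorem isUnit_polarSegment {s : ℝ} (h0 : 0 ≤ s) (h1 : s ≤ 1) {a : Matrix n n ℂ}
    (ha : IsUnit a) : IsUnit (polarSegment s a) := by
  have hp := (posDef_cfcAbs ha).inv
  -- For `s > 0` the summand `s • 1` is already positive definite and the other need only be
  -- semidefinite; at `s = 0` only `|a|⁻¹` is left.
  rcases h0.eq_or_lt with rfl | h0
  · simpa [polarSegment] using hp.isUnit
  · refine Matrix.PosDef.isUnit ?_
    refine Matrix.PosDef.posSemidef_add (hp.posSemidef.smul ?_) (Matrix.PosDef.one.smul ?_)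
    · exact_mod_cast sub_nonneg.2 h1
    · exact_mod_cast h0

end PolarDecomposition

/-! ### The deformation retraction -/

section Deformation

variable {n : ℕ}

/-- The segment from `|a|⁻¹` to `1`, as a path of invertible matrices. -/
noncomputable def polarUnit (s : unitInterval) (a : GL (Fin n) ℂ) : GL (Fin n) ℂ :=
  (isUnit_polarSegment s.2.1 s.2.2 a.isUnit).unit

theorem coe_polarUnit (s : unitInterval) (a : GL (Fin n) ℂ) :
    (polarUnit s a : Matrix (Fin n) (Fin n) ℂ) = polarSegment s a :=
  rfl

theorem polarUnit_one (a : GL (Fin n) ℂ) : polarUnit 1 a = 1 :=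
  Units.ext (by simp [coe_polarUnit, polarSegment])

theorem polarUnit_unitary_mul (s : unitInterval) (u : Matrix.unitaryGroup (Fin n) ℂ)
    (a : GL (Fin n) ℂ) : polarUnit s (Unitary.toUnits u * a) = polarUnit s a := by
  refine Units.ext ?_
  rw [coe_polarUnit, coe_polarUnit, polarSegment, polarSegment, Units.val_mul,
    Unitary.val_toUnits_apply, cfcAbs_unitary_mul]

theorem exists_toUnits_eq_mul_polarUnit_zero (a : GL (Fin n) ℂ) :
    ∃ u : Matrix.unitaryGroup (Fin n) ℂ, Unitary.toUnits u = a * polarUnit 0 a := by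
  refine ⟨⟨_, mul_inv_cfcAbs_mem_unitaryGroup a.isUnit⟩, Units.ext ?_⟩
  rw [Unitary.val_toUnits_apply, Units.val_mul, coe_polarUnit]
  simp [polarSegment]

theorem polarUnit_zero_unitary (u : Matrix.unitaryGroup (Fin n) ℂ) :
    polarUnit 0 (Unitary.toUnits u) = 1 := by
  refine Units.ext ?_
  simp [coe_polarUnit, polarSegment]

/-- A smooth path in the unit interval from `0` to `1`. -/
noncomputable def transitionPath (t : ℝ) : unitInterval :=
  ⟨Real.smoothTransition t, Real.smoothTransition.nonneg t, Real.smoothTransition.le_one t⟩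

theorem transitionPath_zero : transitionPath 0 = 0 :=
  Subtype.ext Real.smoothTransition.zero

theorem transitionPath_one : transitionPath 1 = 1 :=
  Subtype.ext Real.smoothTransition.one

theorem contDiff_transitionPath {s : ℝ → ℝ} (hs : ContDiff ℝ ∞ s) :
    ContDiff ℝ ∞ fun t => (transitionPath (s t) : ℝ) :=
  (Real.smoothTransition.contDiff (n := ⊤)).comp hs

theorem unitarySetoid_rel {A : Type*} [CommRing A] [Algebra ℂ A]
    {g g' : GL (Fin n) A} :
    unitarySetoid n A g g' ↔ ∃ u, unitaryToGL n A u * g = g' := by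
  rw [unitarySetoid, QuotientGroup.rightRel_apply, MonoidHom.mem_range]
  exact exists_congr fun u => eq_mul_inv_iff_mul_eq

variable {A : Type*} [CommRing A] [Algebra ℂ A] [TopologicalSpace A]

/-- A smooth contraction of a topological algebra to the constants: algebra endomorphisms `R s` for
`s` in the unit interval, where `R 1` is the identity and `R 0` is a character, such that `R`
preserves smoothness of curves. -/
structure AlgebraContraction (A : Type*) [CommRing A] [Algebra ℂ A] [TopologicalSpace A] where
  /-- The endomorphism at time `s`. -/
  R : unitInterval → A →ₐ[ℂ] A
  /-- The character to which the algebra is contracted. -/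
  ε : A →ₐ[ℂ] ℂ
  continuous_ε : Continuous ε
  R_one : R 1 = AlgHom.id ℂ A
  R_zero : R 0 = (Algebra.ofId ℂ A).comp ε
  smooth : ∀ {φ : ℝ → unitInterval}, ContDiff ℝ ∞ (fun t => (φ t : ℝ)) →
    ∀ {ι : Type} (s : Finset ι) {a : ι → ℝ → ℂ} {c : ι → ℝ → A}, (∀ i, ContDiff ℝ ∞ (a i)) →
    (∀ i, c i ∈ complexSmoothCurves A) →
    (fun t => ∑ i ∈ s, a i t • R (φ t) (c i t)) ∈ complexSmoothCurves A

namespace AlgebraContraction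

variable (r : AlgebraContraction A)

/-- The value at the centre of an invertible matrix. -/
noncomputable def centre : GL (Fin n) A →* GL (Fin n) ℂ :=
  Matrix.GeneralLinearGroup.map (r.ε : A →+* ℂ)

/-- The deformation of `GL_n(A)` onto `U_n`. -/
noncomputable def deformation (p : GL (Fin n) A × ℝ) : GL (Fin n) A :=
  Matrix.GeneralLinearGroup.map (r.R (transitionPath p.2) : A →+* A) p.1 *
    Matrix.GeneralLinearGroup.map (algebraMap ℂ A) (polarUnit (transitionPath p.2) (r.centre p.1))

theorem map_unitaryToGL (s : unitInterval) (u : Matrix.unitaryGroup (Fin n) ℂ) :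
    Matrix.GeneralLinearGroup.map (r.R s : A →+* A) (unitaryToGL n A u) = unitaryToGL n A u := by
  ext i j
  exact (r.R s).commutes _

theorem centre_unitaryToGL (u : Matrix.unitaryGroup (Fin n) ℂ) :
    r.centre (unitaryToGL n A u) = Unitary.toUnits u := by
  ext i j
  exact r.ε.commutes _

theorem deformation_unitary_mul (u : Matrix.unitaryGroup (Fin n) ℂ) (g : GL (Fin n) A) (t : ℝ) :
    r.deformation (unitaryToGL n A u * g, t) = unitaryToGL n A u * r.deformation (g, t) := by
  simp only [deformation, map_mul, map_unitaryToGL, centre_unitaryToGL, polarUnit_unitary_mul,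
    mul_assoc]

theorem deformation_one (g : GL (Fin n) A) : r.deformation (g, 1) = g := by
  simp only [deformation, transitionPath_one, polarUnit_one, map_one, mul_one, r.R_one]
  ext i j
  rfl

theorem deformation_zero (g : GL (Fin n) A) :
    r.deformation (g, 0) = Matrix.GeneralLinearGroup.map (algebraMap ℂ A)
      (r.centre g * polarUnit 0 (r.centre g)) := by
  simp only [deformation, transitionPath_zero, map_mul, r.R_zero]
  congr 1

theorem deformation_zero_mem_range (g : GL (Fin n) A) :
    r.deformation (g, 0) ∈ (unitaryToGL n A).range := by
  obtain ⟨u, hu⟩ := exists_toUnits_eq_mul_polarUnit_zero (r.centre g)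
  rw [deformation_zero, ← hu]
  exact ⟨u, rfl⟩

theorem deformation_zero_unitary (u : Matrix.unitaryGroup (Fin n) ℂ) :
    r.deformation (unitaryToGL n A u, 0) = unitaryToGL n A u := by
  rw [deformation_zero, centre_unitaryToGL, polarUnit_zero_unitary, mul_one]
  rfl

theorem isSmoothMap_deformation :
    IsSmoothMap (prodCurves (glCurves n A) (smoothCurves ℝ)) (glCurves n A) r.deformation := by
  rintro c ⟨hg, hs⟩
  replace hg := mem_complexSmoothCurves_matrix.1 hg
  have hφ := contDiff_transitionPath (mem_smoothCurves_real_iff_contDiff.1 hs)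
  have hφ' : ContDiff ℝ ∞ fun t => ((transitionPath (c t).2 : ℝ) : ℂ) :=
    Complex.ofRealCLM.contDiff.comp hφ
  have hcentre : ∀ i j, ContDiff ℝ ∞
      fun t => (r.centre (c t).1 : Matrix (Fin n) (Fin n) ℂ) i j := fun i j =>
    mem_complexSmoothCurves_iff_contDiff.1
      (complexSmoothCurves_map (hg i j) r.ε.toLinearMap r.continuous_ε)
  have hW : ∀ i j, ContDiff ℝ ∞ fun t =>
      (polarUnit (transitionPath (c t).2) (r.centre (c t).1) : Matrix (Fin n) (Fin n) ℂ) i j := by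
    intro i j
    have h := contDiff_inv_cfcAbs_apply (fun t => (r.centre (c t).1).isUnit) hcentre i j
    simp only [coe_polarUnit, polarSegment, Matrix.add_apply, Matrix.smul_apply, smul_eq_mul,
      Complex.ofReal_sub, Complex.ofReal_one]
    exact ((contDiff_const.sub hφ').mul h).add (hφ'.mul contDiff_const)
  refine mem_complexSmoothCurves_matrix.2 fun i k => ?_
  -- Entry `(i, k)` of the product is a sum over `j` of smooth scalars times contracted entries `g i
  -- j`, exactly the form covered by `smooth`.
  have h := r.smooth hφ Finset.univ (fun j => hW j k) (fun j => hg i j)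
  refine (congrArg (· ∈ complexSmoothCurves A) (funext fun t => ?_)).mp h
  change _ = (r.deformation (c t) : Matrix (Fin n) (Fin n) A) i k
  rw [deformation, Units.val_mul, Matrix.mul_apply]
  exact Finset.sum_congr rfl fun j _ => by rw [Algebra.smul_def, mul_comm]; rfl

theorem isSmoothUnitaryDeformationRetract (r : AlgebraContraction A) (n : ℕ) :
    IsSmoothUnitaryDeformationRetract n A :=
  ⟨r.deformation, r.isSmoothMap_deformation, r.deformation_unitary_mul, r.deformation_one,
    r.deformation_zero_mem_range, r.deformation_zero_unitary⟩

end AlgebraContraction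

/-- A `U_n`-equivariant smooth deformation retraction of `GL_n(A)` onto `U_n` induces a smooth
contraction of the quotient. -/
theorem IsSmoothUnitaryDeformationRetract.smoothlyContractible
    (h : IsSmoothUnitaryDeformationRetract n A) :
    SmoothlyContractible (quotientCurves (unitarySetoid n A) (glCurves n A)) := by
  obtain ⟨h, hsmooth, hequiv, h1, h0, -⟩ := h
  refine ⟨fun p => Quotient.map (fun g => h (g, p.2)) ?_ p.1, ?_, ?_, Quotient.mk _ 1, ?_⟩
  · rintro g g' hg
    obtain ⟨u, rfl⟩ := unitarySetoid_rel.1 hg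
    exact unitarySetoid_rel.2 ⟨u, (hequiv u g p.2).symm⟩
  · rintro c ⟨hc, hs⟩ t₀
    -- Applying the homotopy upstairs to a local lift gives a local lift of the image curve.
    obtain ⟨γ, hγ, hcγ⟩ := hc t₀
    refine ⟨fun t => h (γ t, (c t).2), hsmooth (fun t => (γ t, (c t).2)) ⟨hγ, hs⟩, ?_⟩
    filter_upwards [hcγ] with t ht
    simp only [ht, Quotient.map_mk]
  · rintro ⟨g⟩
    exact congrArg (Quotient.mk _) (h1 g)
  · rintro ⟨g⟩
    obtain ⟨u, hu⟩ := h0 g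
    exact Quotient.sound ((unitarySetoid n A).symm (unitarySetoid_rel.2 ⟨u, by rw [mul_one, hu]⟩))

end Deformation

/-! ### Polydiscs in complex manifolds -/

section Pullback

variable {E E' : Type*} [NormedAddCommGroup E] [NormedSpace ℂ E] [NormedAddCommGroup E']
  [NormedSpace ℂ E'] {X X' : Type*} [TopologicalSpace X] [ChartedSpace E X] [TopologicalSpace X']
  [ChartedSpace E' X'] {B : TopologicalSpace.Opens X} {B' : TopologicalSpace.Opens X'}

/-- Composition with an analytic map. -/
noncomputable def holomorphicPullback (f : B → B') (hf : ContMDiff 𝓘(ℂ, E) 𝓘(ℂ, E') ω f) :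
    holomorphicFunctions E' B' →ₐ[ℂ] holomorphicFunctions E B where
  toFun g := ⟨g.1.comp ⟨f, hf.continuous⟩,
    have hg : ContMDiff 𝓘(ℂ, E') 𝓘(ℂ) ω g.1 := g.2
    hg.comp hf⟩
  map_one' := rfl
  map_mul' _ _ := rfl
  map_zero' := rfl
  map_add' _ _ := rfl
  commutes' _ := rfl

theorem continuous_holomorphicPullback (f : B → B') (hf : ContMDiff 𝓘(ℂ, E) 𝓘(ℂ, E') ω f) :
    Continuous (holomorphicPullback f hf) :=
  continuous_induced_rng.2
    ((ContinuousMap.continuous_precomp ⟨f, hf.continuous⟩).comp continuous_subtype_val)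

/-- Evaluation of holomorphic functions at a point. -/
noncomputable def holomorphicEval (z : B) : holomorphicFunctions E B →ₐ[ℂ] ℂ where
  toFun f := f.1 z
  map_one' := rfl
  map_mul' _ _ := rfl
  map_zero' := rfl
  map_add' _ _ := rfl
  commutes' _ := rfl

theorem continuous_holomorphicEval (z : B) :
    Continuous (holomorphicEval z : holomorphicFunctions E B →ₐ[ℂ] ℂ) := by
  change Continuous fun f : holomorphicFunctions E B => f.1 z
  fun_prop

/-- The functions on an open polydisc contract smoothly to the constants. -/
noncomputable def polydiscContraction {d : ℕ}
    (e : B ≃ₘ^ω⟮𝓘(ℂ, E), 𝓘(ℂ, Fin d → ℂ)⟯ unitPolydisc d) :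
    AlgebraContraction (holomorphicFunctions E B) where
  R s := ((holomorphicPullback e e.contMDiff).comp (dilate s)).comp
    (holomorphicPullback e.symm e.symm.contMDiff)
  ε := holomorphicEval (e.symm (polydiscCentre d))
  continuous_ε := continuous_holomorphicEval _
  R_one := by
    ext f x
    simp only [dilate_one]
    exact congrArg f.1 (e.symm_apply_apply x)
  R_zero := by
    ext f x
    simp only [AlgHom.comp_apply, dilate_zero]
    rfl
  smooth {φ} hφ {ι} s {a c} ha hc := by
    -- Curves are carried to the unit polydisc and back by continuous linear pullbacks, which
    -- preserve smoothness; the dilation calculus applies in between.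
    have h1 : ∀ i, (fun t => holomorphicPullback e.symm e.symm.contMDiff (c i t)) ∈
        complexSmoothCurves (polydiscFunctions d) := fun i =>
      complexSmoothCurves_map (F := holomorphicFunctions E B) (G := polydiscFunctions d) (hc i)
        (holomorphicPullback e.symm e.symm.contMDiff).toLinearMap
        (continuous_holomorphicPullback e.symm e.symm.contMDiff)
    have h2 := (IsDilationCurve.sum s fun i => (IsDilationCurve.dilate (φ := φ) (h1 i)).smul
      (ha i)).mem_complexSmoothCurves hφ
    have h3 := complexSmoothCurves_map (F := polydiscFunctions d) (G := holomorphicFunctions E B) h2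
      (holomorphicPullback e e.contMDiff).toLinearMap
      (continuous_holomorphicPullback e e.contMDiff)
    refine (congrArg (· ∈ complexSmoothCurves (holomorphicFunctions E B))
      (funext fun t => ?_)).mp h3
    rw [map_sum]
    simp only [map_smul]
    rfl

end Pullback

theorem mainTheorem8 {E : Type*} [NormedAddCommGroup E] [NormedSpace ℂ E] [FiniteDimensional ℂ E]
    {X : Type*} [TopologicalSpace X] [ChartedSpace E X] [IsManifold 𝓘(ℂ, E) ω X]
    (B : TopologicalSpace.Opens X) (hB : IsOpenPolydisc E B) (n : ℕ) :
    IsSmoothUnitaryDeformationRetract n (holomorphicFunctions E B) ∧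
    SmoothlyContractible (quotientCurves (unitarySetoid n (holomorphicFunctions E B))
      (glCurves n (holomorphicFunctions E B))) := by
  obtain ⟨d, ⟨e⟩⟩ := hB
  have h := (polydiscContraction e).isSmoothUnitaryDeformationRetract n
  exact ⟨h, h.smoothlyContractible⟩
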